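/- Let $n+1>2$ and let $\mathcal K=\{(x_0;x_1)\in\mathbb R\times\mathbb R^{n}:\|x_1\|_2\le x_0\}\subset\mathbb R^{n+1}$ be the second-order cone, with interior $\operatorname{int}\mathcal K$ and boundary $\operatorname{bd}\mathcal K$. Let $H\subset\mathbb R^{n+1}$ be an affine subspace with $H\cap\mathcal K\ne\emptyset$ and $H\cap\operatorname{int}\mathcal K=\emptyset$. Let $P_{\mathcal K}$ and $P_H$ be the Euclidean projections onto $\mathcal K$ and $H$, let $u_0\in H\setminus\mathcal K$, and let $u_{k+1}=P_H(P_{\mathcal K}(u_k))$ for $k=0,1,2,\dots$. For $d\in\mathbb R^{n+1}$ put $C(d)=\{\alpha d:\alpha\ge 0\}$. Say that $(u_k)$ converges to $w$ at $\Theta(k^{-1/2})$ rate if $u_k\to w$ and there are $d_1,d_2>0$ and $\tilde k\in\mathbb N$ with $d_1k^{-1/2}\le\|u_k-w\|\le d_2k^{-1/2}$ for all $k\ge\tilde k$. Then: 1. If $H\cap\operatorname{bd}\mathcal K=\{0\}$, then $(u_k)$ converges to $0$ at a linear rate: there is $r\in(0,1)$ with $\|u_{k+1}\|\le r\|u_k\|$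 for all $k\ge 0$. 2. If $H\cap\operatorname{bd}\mathcal K=\{u_*\}$ with $u_*\ne 0$, then $(u_k)$ converges to $u_*$ at $\Theta(k^{-1/2})$ rate. 3. If $H\cap\operatorname{bd}\mathcal K=C(d)$ for some $d\in\operatorname{bd}\mathcal K\setminus\{0\}$, then either $u_1=0$, or $(u_k)$ converges at $\Theta(k^{-1/2})$ rate to a point of $C(d)$ other than $0$. -/

import Mathlib

open Filter Topology Asymptotics

/-- The second-order cone `{(x₀; x₁) ∈ ℝ × ℝⁿ : ‖x₁‖₂ ≤ x₀}` in `ℝⁿ⁺¹`; the coordinate `x 0` is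
`x₀`, and the coordinates `x i.succ` form the vector `x₁`. -/
def secondOrderCone (n : ℕ) : Set (EuclideanSpace ℝ (Fin (n + 1))) :=
  {x | Real.sqrt (∑ i : Fin n, x i.succ ^ 2) ≤ x 0}

/-- `p` is a metric projection of `x` onto `S`, i.e. a point of `S` nearest to `x`
(it exists and is unique when `S` is nonempty, closed and convex in a Euclidean space). -/
def IsMetricProj {E : Type*} [PseudoMetricSpace E] (S : Set E) (x p : E) : Prop :=
  p ∈ S ∧ ∀ q ∈ S, dist x p ≤ dist x q

/-- The sequence `u` starts at a point of `H` and satisfies `u (k + 1) = P_H (P_K (u k))`. -/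
def IsAlternatingProjSeq {E : Type*} [PseudoMetricSpace E] (H K : Set E) (u : ℕ → E) : Prop :=
  u 0 ∈ H ∧ ∀ k : ℕ, ∃ v : E, IsMetricProj K (u k) v ∧ IsMetricProj H v (u (k + 1))

/-- The half-line `C(d) = {α d : α ≥ 0}`. -/
def halfLine {E : Type*} [AddCommGroup E] [Module ℝ E] (d : E) : Set E :=
  {x | ∃ α : ℝ, 0 ≤ α ∧ x = α • d}

/-- The sequence `u` converges to `w` at a linear rate. -/
def ConvergesLinearly {E : Type*} [NormedAddCommGroup E] (u : ℕ → E) (w : E) : Prop :=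
  Tendsto u atTop (𝓝 w) ∧
    ∃ r : ℝ, 0 < r ∧ r < 1 ∧ ∀ k : ℕ, ‖u (k + 1) - w‖ ≤ r * ‖u k - w‖

/-- The sequence `u` converges to `w` at the exact rate `Θ(k ^ (-1/2))`. -/
def ConvergesThetaInvSqrt {E : Type*} [NormedAddCommGroup E] (u : ℕ → E) (w : E) : Prop :=
  Tendsto u atTop (𝓝 w) ∧
    (fun k : ℕ => ‖u k - w‖) =Θ[atTop] (fun k : ℕ => (k : ℝ) ^ (-(1 / 2) : ℝ))

/-!
Everything is expressed by the Lorentz form `q(x) = ‖x₁‖² - x₀²` and the gap `δ = s - x₀` with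
`s = ‖x₁‖`, where `q = δ (s + x₀)`.

If `H` touches the cone at `p ≠ 0` without meeting its interior, then `H` lies in the tangent
hyperplane at `p`, that is, its directions are Lorentz-orthogonal to the null vector `p`
(`lorentzForm_direction_eq_zero`), and on this hyperplane `q` is positive semidefinite with kernel
`ℝ p`. Hence the iterates have `q ≥ 0`, and the projection onto the cone is given by one closed formula
(`coneProj`). It yields, for `p ∈ H` in the cone and consecutive iterates `u, u'`,
`‖u' - p‖² ≤ ‖u - p‖² - δ² / 2 - p₀ δ² / s` and
`⟪u' - p, u - p⟫ = ‖u - p‖² - δ² / 2 - p₀ δ² / (2 s)`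
(`norm_altProj_sub_sq_le`, `inner_altProj_sub`).

* If the intersection is `{0}`, then `q` is positive definite on `H`, so `δ ≥ c ‖u‖` and the first
  estimate with `p = 0` is a linear contraction.
* If it is `{p}` with `p ≠ 0`, then `q` is positive definite on the directions of `H`. Now `s + x₀` stays
  bounded and tends to `2 p₀ > 0`, so `δ` is of the exact order `‖u - p‖²`, and `y = ‖u - p‖²` satisfies
  `y - C y² ≤ y' ≤ y - c y²`, whence `y = Θ(1 / k)` (`isTheta_sqrt_of_quadratic_decrease`).
* If it is a ray, the step is explicit: `u'` lies in the plane of `u` and `d`, with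
  `q(u') = ((1 + x₀ / s) / 2)² q(u)` and `x₀' = x₀ + δ² / (4 s)`. Again `q` satisfies the quadratic
  recurrence, while `x₀` converges to a positive limit `X` with `X - x₀ = O(√q)`, so that the distance
  to the limit point has the order of `√q`.
-/

/-! ### The Lorentz form and the projection onto the cone -/

/-- The Euclidean norm `‖x₁‖₂` of the spatial part of `x = (x₀; x₁)`. -/
noncomputable def spatialNorm {n : ℕ} (x : EuclideanSpace ℝ (Fin (n + 1))) : ℝ :=
  Real.sqrt (∑ i : Fin n, x i.succ ^ 2)

/-- The Lorentz form `⟪x₁, y₁⟫ - x₀ y₀` on `ℝ × ℝⁿ`, positive on the spatial part. It is written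
through the Euclidean inner product of `ℝⁿ⁺¹`, which makes it independent of coordinates of `x₁`. -/
noncomputable def lorentzForm {n : ℕ} (x y : EuclideanSpace ℝ (Fin (n + 1))) : ℝ :=
  inner ℝ x y - 2 * (x 0 * y 0)

/-- The closed form of the projection onto the second-order cone, for points with
`0 ≤ lorentzForm x x`, i.e. `|x₀| ≤ ‖x₁‖`. The classical formula `(1 + x₀ / s) / 2 • (s; x₁)` with
`s = ‖x₁‖` is rewritten as a combination of `x` and the unit vector of the time axis. At `x = 0`
the divisions by zero give the correct value `0`. -/
noncomputable def coneProj {n : ℕ} (x : EuclideanSpace ℝ (Fin (n + 1))) :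
    EuclideanSpace ℝ (Fin (n + 1)) :=
  ((1 + x 0 / spatialNorm x) / 2) • x +
    (lorentzForm x x / (2 * spatialNorm x)) • EuclideanSpace.single 0 1

section cone
variable {n : ℕ} (x y p : EuclideanSpace ℝ (Fin (n + 1)))

theorem spatialNorm_nonneg : 0 ≤ spatialNorm x := Real.sqrt_nonneg _

theorem continuous_spatialNorm :
    Continuous (spatialNorm : EuclideanSpace ℝ (Fin (n + 1)) → ℝ) := by
  unfold spatialNorm; fun_prop

theorem sq_spatialNorm : spatialNorm x ^ 2 = ‖x‖ ^ 2 - x 0 ^ 2 := by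
  rw [spatialNorm, Real.sq_sqrt (Finset.sum_nonneg fun i _ => sq_nonneg _),
    EuclideanSpace.real_norm_sq_eq, Fin.sum_univ_succ]
  ring

theorem spatialNorm_le_norm : spatialNorm x ≤ ‖x‖ :=
  le_of_sq_le_sq (by nlinarith [sq_spatialNorm x, sq_nonneg (x 0)]) (norm_nonneg _)

theorem lorentzForm_self : lorentzForm x x = ‖x‖ ^ 2 - 2 * x 0 ^ 2 := by
  rw [lorentzForm, real_inner_self_eq_norm_sq]; ring

theorem lorentzForm_self_eq_mul :
    lorentzForm x x = (spatialNorm x - x 0) * (spatialNorm x + x 0) := by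
  rw [lorentzForm_self]; linear_combination -sq_spatialNorm x

theorem inner_sub_le_spatialNorm_mul :
    inner ℝ x y - x 0 * y 0 ≤ spatialNorm x * spatialNorm y := by
  have h : inner ℝ x y - x 0 * y 0 = ∑ i : Fin n, x i.succ * y i.succ := by
    rw [PiLp.inner_apply, Fin.sum_univ_succ]
    simp [mul_comm]
  rw [h]
  exact Real.sum_mul_le_sqrt_mul_sqrt _ _ _

variable {x y p}

theorem abs_le_spatialNorm (hq : 0 ≤ lorentzForm x x) : |x 0| ≤ spatialNorm x := by
  apply abs_le_of_sq_le_sq _ (spatialNorm_nonneg x)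
  rw [lorentzForm_self_eq_mul] at hq
  nlinarith

theorem eq_zero_of_spatialNorm_eq_zero (hq : 0 ≤ lorentzForm x x) (hs : spatialNorm x = 0) :
    x = 0 := by
  have h0 : x 0 = 0 := by simpa [hs] using abs_le_spatialNorm hq
  have := sq_spatialNorm x
  rw [hs, h0] at this
  simpa using this.symm

theorem mem_secondOrderCone_iff : x ∈ secondOrderCone n ↔ spatialNorm x ≤ x 0 := Iff.rfl

theorem mem_secondOrderCone_of_lorentzForm (h0 : 0 ≤ x 0) (hq : lorentzForm x x ≤ 0) :
    x ∈ secondOrderCone n := by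
  rw [mem_secondOrderCone_iff]
  apply le_of_sq_le_sq _ h0
  rw [lorentzForm_self_eq_mul] at hq
  nlinarith

theorem isClosed_secondOrderCone : IsClosed (secondOrderCone n) := by
  have : Continuous fun x : EuclideanSpace ℝ (Fin (n + 1)) => x 0 := by fun_prop
  exact isClosed_le continuous_spatialNorm this

theorem mem_interior_secondOrderCone (h : spatialNorm x < x 0) :
    x ∈ interior (secondOrderCone n) := by
  have hc : Continuous fun x : EuclideanSpace ℝ (Fin (n + 1)) => x 0 := by fun_prop
  exact interior_maximal (fun y (hy : spatialNorm y < y 0) => hy.le)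
    (isOpen_lt continuous_spatialNorm hc) h

theorem lorentzForm_comm : lorentzForm x y = lorentzForm y x := by
  rw [lorentzForm, lorentzForm, real_inner_comm]; ring

theorem lorentzForm_self_add_smul (a b : ℝ) :
    lorentzForm (a • x + b • y) (a • x + b • y) =
      a ^ 2 * lorentzForm x x + 2 * (a * b) * lorentzForm x y + b ^ 2 * lorentzForm y y := by
  simp only [lorentzForm, inner_add_left, inner_add_right, real_inner_smul_left,
    real_inner_smul_right, PiLp.add_apply, PiLp.smul_apply, smul_eq_mul, real_inner_comm x y]
  ring

/-- On the Lorentz-orthogonal complement of a null vector `p` the form is positive semidefinite, and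
its kernel is the line through `p`. -/
theorem lorentzForm_self_eq_norm_sq (hp0 : p 0 ≠ 0) (hp : lorentzForm p p = 0)
    (hpx : lorentzForm p x = 0) : lorentzForm x x = ‖x - (x 0 / p 0) • p‖ ^ 2 := by
  have h1 := lorentzForm_self_add_smul (x := x) (y := p) 1 (-(x 0 / p 0))
  rw [lorentzForm_self, hp, lorentzForm_comm (x := x) (y := p), hpx] at h1
  have h2 : (1 : ℝ) • x + (-(x 0 / p 0)) • p = x - (x 0 / p 0) • p := by
    rw [one_smul, neg_smul, sub_eq_add_neg]
  have h3 : (x - (x 0 / p 0) • p) 0 = 0 := by simp [hp0]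
  rw [h2, h3] at h1
  linarith

theorem inner_single_zero : inner ℝ (EuclideanSpace.single (0 : Fin (n + 1)) (1 : ℝ)) x = x 0 := by
  simp [EuclideanSpace.inner_single_left]

theorem coneProj_zero : coneProj (0 : EuclideanSpace ℝ (Fin (n + 1))) = 0 := by
  simp [coneProj, lorentzForm]

theorem inner_sub_coneProj (hs : spatialNorm x ≠ 0) :
    inner ℝ (x - coneProj x) y = (spatialNorm x - x 0) / (2 * spatialNorm x) *
      (inner ℝ x y - (spatialNorm x + x 0) * y 0) := by
  rw [coneProj, inner_sub_left, inner_add_left, real_inner_smul_left, real_inner_smul_left,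
    inner_single_zero, lorentzForm_self_eq_mul]
  field_simp
  ring

theorem inner_sub_coneProj_self (hs : spatialNorm x ≠ 0) :
    inner ℝ (x - coneProj x) x = (spatialNorm x - x 0) ^ 2 / 2 := by
  rw [inner_sub_coneProj hs, real_inner_self_eq_norm_sq]
  have := sq_spatialNorm x
  field_simp
  linear_combination (spatialNorm x - x 0) * (-this)

theorem inner_sub_coneProj_of_lorentzForm (hs : spatialNorm x ≠ 0) (hp : lorentzForm p x = 0) :
    inner ℝ (x - coneProj x) p = -(p 0 * (spatialNorm x - x 0) ^ 2 / (2 * spatialNorm x)) := by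
  rw [inner_sub_coneProj hs]
  have : inner ℝ x p = 2 * (p 0 * x 0) := by
    rw [real_inner_comm]; unfold lorentzForm at hp; linarith
  rw [this]
  field_simp
  ring

theorem coneProj_apply_zero (hs : spatialNorm x ≠ 0) :
    coneProj x 0 = (spatialNorm x + x 0) / 2 := by
  simp only [coneProj, PiLp.add_apply, PiLp.smul_apply, smul_eq_mul, lorentzForm_self_eq_mul]
  simp
  field_simp
  ring

theorem inner_sub_coneProj_coneProj (hs : spatialNorm x ≠ 0) :
    inner ℝ (x - coneProj x) (coneProj x) = 0 := by
  rw [inner_sub_coneProj hs, coneProj_apply_zero hs]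
  have h : inner ℝ x (coneProj x) = (spatialNorm x + x 0) ^ 2 / 2 := by
    have h1 := inner_sub_coneProj_self hs
    rw [inner_sub_left, real_inner_self_eq_norm_sq, real_inner_comm] at h1
    linarith [sq_spatialNorm x]
  rw [h]; ring

theorem norm_sub_coneProj_sq (hs : spatialNorm x ≠ 0) :
    ‖x - coneProj x‖ ^ 2 = (spatialNorm x - x 0) ^ 2 / 2 := by
  rw [← inner_sub_coneProj_self hs, ← real_inner_self_eq_norm_sq]
  conv_lhs => rw [inner_sub_right]
  rw [inner_sub_coneProj_coneProj hs, sub_zero]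

theorem coneProj_mem (hq : 0 ≤ lorentzForm x x) : coneProj x ∈ secondOrderCone n := by
  by_cases hs : spatialNorm x = 0
  · rw [eq_zero_of_spatialNorm_eq_zero hq hs, coneProj_zero]
    simp [secondOrderCone]
  have hx := abs_le.1 (abs_le_spatialNorm hq)
  apply mem_secondOrderCone_of_lorentzForm
  · rw [coneProj_apply_zero hs]; linarith
  · have h1 := inner_sub_coneProj_coneProj hs
    have h2 := inner_sub_coneProj_self hs
    have h3 := sq_spatialNorm x
    rw [lorentzForm_self, coneProj_apply_zero hs]
    rw [inner_sub_left, real_inner_self_eq_norm_sq] at h1 h2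
    rw [real_inner_comm] at h2
    nlinarith

theorem inner_sub_coneProj_nonpos (hq : 0 ≤ lorentzForm x x) (hy : y ∈ secondOrderCone n) :
    inner ℝ (x - coneProj x) y ≤ 0 := by
  by_cases hs : spatialNorm x = 0
  · rw [eq_zero_of_spatialNorm_eq_zero hq hs, coneProj_zero]
    simp
  have hx := abs_le.1 (abs_le_spatialNorm hq)
  have hs0 := spatialNorm_nonneg x
  rw [inner_sub_coneProj hs]
  apply mul_nonpos_of_nonneg_of_nonpos
  · exact div_nonneg (by linarith) (by linarith)
  · have h1 := inner_sub_le_spatialNorm_mul x y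
    have h2 := mul_le_mul_of_nonneg_left (mem_secondOrderCone_iff.1 hy) hs0
    linarith

end cone

/-! ### Metric projections -/

/-- A point satisfying the obtuse-angle inequality is the only metric projection; neither
convexity nor closedness of `S` is needed for this direction. -/
theorem IsMetricProj.eq_of_inner_nonpos {E : Type*} [NormedAddCommGroup E]
    [InnerProductSpace ℝ E] {S : Set E} {x p v : E} (hv : IsMetricProj S x v) (hp : p ∈ S)
    (h : ∀ y ∈ S, inner ℝ (x - p) (y - p) ≤ 0) : v = p := by
  have h1 := hv.2 p hp
  have h2 := h v hv.1
  rw [dist_eq_norm, dist_eq_norm] at h1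
  have h3 : ‖x - v‖ ^ 2 = ‖x - p‖ ^ 2 - 2 * inner ℝ (x - p) (v - p) + ‖v - p‖ ^ 2 := by
    rw [← norm_sub_sq_real, sub_sub_sub_cancel_right]
  have h4 : ‖v - p‖ ^ 2 ≤ 0 := by nlinarith [norm_nonneg (x - v)]
  have h5 : ‖v - p‖ = 0 := by nlinarith [norm_nonneg (v - p)]
  exact sub_eq_zero.1 (norm_eq_zero.1 h5)

theorem IsMetricProj.inner_sub_eq_zero {E : Type*} [NormedAddCommGroup E]
    [InnerProductSpace ℝ E] {H : AffineSubspace ℝ E} {x v : E}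
    (hv : IsMetricProj (H : Set E) x v) {g : E} (hg : g ∈ H.direction) :
    inner ℝ (x - v) g = 0 := by
  by_contra hne
  set a : ℝ := inner ℝ (x - v) g with ha
  -- The point of the line `v + ℝ g` nearest to `x` would be strictly better than `v`.
  have hgn : 0 < ‖g‖ ^ 2 := by
    have : g ≠ 0 := by rintro rfl; simp at ha; exact hne ha
    positivity
  have hm : (a / ‖g‖ ^ 2) • g + v ∈ H :=
    AffineSubspace.vadd_mem_of_mem_direction (H.direction.smul_mem _ hg) hv.1
  have h1 := hv.2 _ hm
  rw [dist_eq_norm, dist_eq_norm] at h1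
  have h2 : ‖x - ((a / ‖g‖ ^ 2) • g + v)‖ ^ 2 = ‖x - v‖ ^ 2 - a ^ 2 / ‖g‖ ^ 2 := by
    have : x - ((a / ‖g‖ ^ 2) • g + v) = (x - v) - (a / ‖g‖ ^ 2) • g := by abel
    rw [this, norm_sub_sq_real, real_inner_smul_right, ← ha, norm_smul, mul_pow,
      Real.norm_eq_abs, sq_abs]
    field_simp
    ring
  have h3 : 0 < a ^ 2 / ‖g‖ ^ 2 := by positivity
  nlinarith [norm_nonneg (x - v)]

theorem IsMetricProj.eq_coneProj {n : ℕ} {x v : EuclideanSpace ℝ (Fin (n + 1))}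
    (hv : IsMetricProj (secondOrderCone n) x v) (hq : 0 ≤ lorentzForm x x) : v = coneProj x := by
  refine hv.eq_of_inner_nonpos (coneProj_mem hq) fun y hy => ?_
  by_cases hs : spatialNorm x = 0
  · rw [eq_zero_of_spatialNorm_eq_zero hq hs, coneProj_zero]
    simp
  rw [inner_sub_right, inner_sub_coneProj_coneProj hs, sub_zero]
  exact inner_sub_coneProj_nonpos hq hy

/-! ### Sequences with quadratic decrease -/

/-- Each step `y ↦ y - c y²` raises `1 / y` by at least `c`. -/
theorem mul_le_inv_of_quadratic_decrease {y : ℕ → ℝ} {c : ℝ} (hc : 0 < c) (hy : ∀ k, 0 < y k)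
    (h : ∀ k, y (k + 1) ≤ y k - c * y k ^ 2) (k : ℕ) : c * k ≤ (y k)⁻¹ := by
  induction k with
  | zero => simpa using (hy 0).le
  | succ k ih =>
    have h1 := hy k
    have h2 := hy (k + 1)
    have h3 : (y k)⁻¹ + c ≤ (y (k + 1))⁻¹ := by
      rw [le_inv_comm₀ (by positivity) h2]
      refine (h k).trans ?_
      rw [← one_div, le_div_iff₀ (by positivity)]
      have : (y k - c * y k ^ 2) * ((y k)⁻¹ + c) = 1 - (c * y k) ^ 2 := by
        field_simp
        ring
      rw [this]
      nlinarith [sq_nonneg (c * y k)]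
    push_cast
    linarith

theorem tendsto_zero_of_quadratic_decrease {y : ℕ → ℝ} {c : ℝ} (hc : 0 < c) (hy : ∀ k, 0 < y k)
    (h : ∀ k, y (k + 1) ≤ y k - c * y k ^ 2) : Tendsto y atTop (𝓝 0) := by
  have hlim := tendsto_inv_atTop_zero.comp (tendsto_atTop_mono (mul_le_inv_of_quadratic_decrease hc hy h)
    (tendsto_natCast_atTop_atTop.const_mul_atTop hc))
  simpa [Function.comp_def] using hlim

/-- If `y - C y² ≤ y' ≤ y - c y²` at each (late) step, then `1 / y` grows by an amount between
`c` and `2 C` per step, so that `y = Θ(1 / k)`. -/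
theorem isTheta_sqrt_of_quadratic_decrease {y : ℕ → ℝ} {c C : ℝ} (hc : 0 < c) (hC : 0 < C)
    (hy : ∀ k, 0 < y k) (h : ∀ k, y (k + 1) ≤ y k - c * y k ^ 2)
    (h' : ∀ᶠ k in atTop, y k - C * y k ^ 2 ≤ y (k + 1)) :
    (fun k => Real.sqrt (y k)) =Θ[atTop] (fun k : ℕ => (k : ℝ) ^ (-(1 / 2) : ℝ)) := by
  have hlow := mul_le_inv_of_quadratic_decrease hc hy h
  have hsmall : ∀ᶠ k in atTop, y k < (2 * C)⁻¹ := (tendsto_zero_of_quadratic_decrease hc hy h).eventually_lt_const (by positivity)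
  obtain ⟨N, hN⟩ := eventually_atTop.1 (hsmall.and h')
  have hup : ∀ j : ℕ, (y (N + j))⁻¹ ≤ (y N)⁻¹ + 2 * C * j := by
    intro j
    induction j with
    | zero => simp
    | succ j ih =>
      obtain ⟨h1, h2⟩ := hN (N + j) (by omega)
      have h3 := hy (N + j)
      have h4 := hy (N + j + 1)
      have h5 : (y (N + j + 1))⁻¹ ≤ (y (N + j))⁻¹ + 2 * C := by
        rw [inv_le_comm₀ h4 (by positivity)]
        refine le_trans ?_ h2
        rw [← one_div, div_le_iff₀ (by positivity)]
        have h6 : (y (N + j) - C * y (N + j) ^ 2) * ((y (N + j))⁻¹ + 2 * C) =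
            1 + C * y (N + j) * (1 - 2 * C * y (N + j)) := by
          field_simp
          ring
        have h7 : 2 * C * y (N + j) ≤ 1 := by
          rw [← one_div, lt_div_iff₀ (by positivity)] at h1; linarith
        rw [h6]
        have : 0 ≤ C * y (N + j) * (1 - 2 * C * y (N + j)) :=
          mul_nonneg (by positivity) (by linarith)
        linarith
      rw [← add_assoc]
      push_cast
      linarith
  have hrpow : ∀ k : ℕ, (k : ℝ) ^ (-(1 / 2) : ℝ) = Real.sqrt ((k : ℝ)⁻¹) := fun k => by
    rw [Real.rpow_neg (by positivity), ← Real.sqrt_eq_rpow, Real.sqrt_inv]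
  simp only [hrpow]
  constructor
  · refine IsBigO.of_bound (Real.sqrt c⁻¹) ?_
    filter_upwards [eventually_gt_atTop 0] with k hk
    have hk' : (0 : ℝ) < k := by exact_mod_cast hk
    rw [Real.norm_of_nonneg (Real.sqrt_nonneg _), Real.norm_of_nonneg (Real.sqrt_nonneg _),
      ← Real.sqrt_mul (by positivity), ← mul_inv]
    exact Real.sqrt_le_sqrt ((le_inv_comm₀ (by positivity) (hy k)).1 (hlow k))
  · set D : ℝ := (y N)⁻¹ + 2 * C with hD
    have hD0 : 0 < D := by have := hy N; positivity
    refine IsBigO.of_bound (Real.sqrt D) ?_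
    filter_upwards [eventually_gt_atTop 0, eventually_ge_atTop N] with k hk hkN
    have hk' : (1 : ℝ) ≤ k := by exact_mod_cast hk
    rw [Real.norm_of_nonneg (Real.sqrt_nonneg _), Real.norm_of_nonneg (Real.sqrt_nonneg _),
      ← Real.sqrt_mul (by positivity)]
    refine Real.sqrt_le_sqrt ?_
    obtain ⟨j, rfl⟩ := Nat.exists_eq_add_of_le hkN
    have h1 := hup j
    have hyN := inv_pos.2 (hy N)
    have h2 : (y (N + j))⁻¹ ≤ D * (N + j : ℕ) := by
      push_cast at hk' ⊢
      have : (y N)⁻¹ ≤ (y N)⁻¹ * (N + j) := le_mul_of_one_le_right hyN.le hk'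
      have h3 : 2 * C * (j : ℝ) ≤ 2 * C * (N + j) := by
        apply mul_le_mul_of_nonneg_left _ (by positivity)
        linarith [Nat.cast_nonneg (α := ℝ) N]
      rw [hD]
      linarith
    rw [inv_le_iff_one_le_mul₀ (by linarith)]
    rw [inv_le_iff_one_le_mul₀ (hy _)] at h2
    linarith

theorem tendsto_natCast_rpow_neg_half :
    Tendsto (fun k : ℕ => (k : ℝ) ^ (-(1 / 2) : ℝ)) atTop (𝓝 0) :=
  (tendsto_rpow_neg_atTop (by norm_num)).comp tendsto_natCast_atTop_atTop

theorem ConvergesThetaInvSqrt.of_isTheta {E : Type*} [NormedAddCommGroup E] {u : ℕ → E} {w : E}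
    (h : (fun k : ℕ => ‖u k - w‖) =Θ[atTop] (fun k : ℕ => (k : ℝ) ^ (-(1 / 2) : ℝ))) :
    ConvergesThetaInvSqrt u w :=
  ⟨tendsto_iff_norm_sub_tendsto_zero.2 (h.1.trans_tendsto tendsto_natCast_rpow_neg_half), h⟩

/-! ### Supporting hyperplanes and one step of the iteration -/

section

variable {n : ℕ} {H : AffineSubspace ℝ (EuclideanSpace ℝ (Fin (n + 1)))}
  {u v u' p : EuclideanSpace ℝ (Fin (n + 1))}

theorem inter_frontier_secondOrderCone
    (hint : (H : Set (EuclideanSpace ℝ (Fin (n + 1)))) ∩ interior (secondOrderCone n) = ∅) :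
    (H : Set (EuclideanSpace ℝ (Fin (n + 1)))) ∩ frontier (secondOrderCone n) =
      (H : Set (EuclideanSpace ℝ (Fin (n + 1)))) ∩ secondOrderCone n := by
  ext x
  rw [isClosed_secondOrderCone.frontier_eq]
  constructor
  · exact fun h => ⟨h.1, h.2.1⟩
  · exact fun h => ⟨h.1, h.2, fun h' => (hint.le ⟨h.1, h'⟩).elim⟩

theorem spatialNorm_eq_of_mem
    (hint : (H : Set (EuclideanSpace ℝ (Fin (n + 1)))) ∩ interior (secondOrderCone n) = ∅)
    (hpH : p ∈ H) (hpK : p ∈ secondOrderCone n) : spatialNorm p = p 0 := by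
  refine le_antisymm hpK (not_lt.1 fun h => ?_)
  exact (hint.le ⟨hpH, mem_interior_secondOrderCone h⟩).elim

theorem zero_lt_apply_zero_of_mem (hpK : p ∈ secondOrderCone n) (hp : p ≠ 0) : 0 < p 0 := by
  have h1 := mem_secondOrderCone_iff.1 hpK
  have h2 := spatialNorm_nonneg p
  refine lt_of_le_of_ne (h2.trans h1) fun h0 => hp ?_
  have h3 : spatialNorm p = 0 := by linarith
  apply eq_zero_of_spatialNorm_eq_zero _ h3
  rw [lorentzForm_self_eq_mul, h3, ← h0]
  simp

/-- If `H` misses the interior of the cone and touches it at `p ≠ 0`, then `H` lies in the tangent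
hyperplane at `p`, which is the Lorentz-orthogonal complement of `p`: otherwise a small step along a
direction of `H` would make the form negative. -/
theorem lorentzForm_direction_eq_zero
    (hint : (H : Set (EuclideanSpace ℝ (Fin (n + 1)))) ∩ interior (secondOrderCone n) = ∅)
    (hpH : p ∈ H) (hpK : p ∈ secondOrderCone n) (hp : p ≠ 0)
    {h : EuclideanSpace ℝ (Fin (n + 1))} (hh : h ∈ H.direction) : lorentzForm p h = 0 := by
  by_contra hb
  set b := lorentzForm p h with hbdef
  have hp0 := zero_lt_apply_zero_of_mem hpK hp
  have hpp : lorentzForm p p = 0 := by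
    rw [lorentzForm_self_eq_mul, spatialNorm_eq_of_mem hint hpH hpK, sub_self, zero_mul]
  have e1 : ∀ᶠ ε : ℝ in 𝓝[>] 0, 0 < 2 - ε * lorentzForm h h := by
    have : ContinuousAt (fun ε : ℝ => 2 - ε * lorentzForm h h) 0 := by fun_prop
    exact (this.eventually (lt_mem_nhds (by simp))).filter_mono nhdsWithin_le_nhds
  have e2 : ∀ᶠ ε : ℝ in 𝓝[>] 0, 0 < p 0 - ε * (b * h 0) := by
    have : ContinuousAt (fun ε : ℝ => p 0 - ε * (b * h 0)) 0 := by fun_prop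
    exact (this.eventually (lt_mem_nhds (by simpa using hp0))).filter_mono nhdsWithin_le_nhds
  obtain ⟨ε, ⟨h1, h2⟩, h3⟩ := ((e1.and e2).and self_mem_nhdsWithin).exists
  have h3 : 0 < ε := h3
  have hm : (-(ε * b)) • h + (1 : ℝ) • p ∈ H := by
    rw [one_smul]
    exact AffineSubspace.vadd_mem_of_mem_direction (H.direction.smul_mem _ hh) hpH
  set x := (-(ε * b)) • h + (1 : ℝ) • p with hx
  have hx0 : 0 < x 0 := by
    simp only [hx, PiLp.add_apply, PiLp.smul_apply, smul_eq_mul]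
    linarith
  have hxq : lorentzForm x x < 0 := by
    rw [hx, lorentzForm_self_add_smul, hpp, lorentzForm_comm (y := p), ← hbdef]
    have : 0 < ε * b ^ 2 * (2 - ε * lorentzForm h h) := by positivity
    linarith
  have hK := mem_secondOrderCone_of_lorentzForm hx0.le hxq.le
  have := spatialNorm_eq_of_mem hint hm hK
  rw [lorentzForm_self_eq_mul, this, sub_self, zero_mul] at hxq
  exact lt_irrefl _ hxq

/-- The inner product of consecutive errors, exactly. It bounds the new error from below by
Cauchy–Schwarz. -/
theorem inner_altProj_sub (hv : IsMetricProj (secondOrderCone n) u v)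
    (hu' : IsMetricProj (H : Set (EuclideanSpace ℝ (Fin (n + 1)))) v u')
    (hu : u ∈ H) (hp : p ∈ H) (hq : 0 ≤ lorentzForm u u) (hs : spatialNorm u ≠ 0)
    (hpu : lorentzForm p u = 0) :
    inner ℝ (u' - p) (u - p) = ‖u - p‖ ^ 2 -
      ((spatialNorm u - u 0) ^ 2 / 2 + p 0 * (spatialNorm u - u 0) ^ 2 / (2 * spatialNorm u)) := by
  have h1 := hu'.inner_sub_eq_zero (AffineSubspace.vsub_mem_direction hu hp)
  rw [vsub_eq_sub] at h1
  have h2 : u' - p = (u - p) - (u - v) - (v - u') := by abel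
  rw [h2, inner_sub_left, h1, inner_sub_left, real_inner_self_eq_norm_sq, inner_sub_right (u - v),
    hv.eq_coneProj hq, inner_sub_coneProj_self hs, inner_sub_coneProj_of_lorentzForm hs hpu]
  ring

/-- Quantitative Fejér monotonicity of one step with respect to a point `p` of `H` to which the
iterate is Lorentz-orthogonal. -/
theorem norm_altProj_sub_sq_le (hv : IsMetricProj (secondOrderCone n) u v)
    (hu' : IsMetricProj (H : Set (EuclideanSpace ℝ (Fin (n + 1)))) v u')
    (hp : p ∈ H) (hq : 0 ≤ lorentzForm u u) (hs : spatialNorm u ≠ 0)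
    (hpu : lorentzForm p u = 0) :
    ‖u' - p‖ ^ 2 ≤ ‖u - p‖ ^ 2 -
      ((spatialNorm u - u 0) ^ 2 / 2 + p 0 * (spatialNorm u - u 0) ^ 2 / spatialNorm u) := by
  have h1 := hu'.inner_sub_eq_zero (AffineSubspace.vsub_mem_direction hu'.1 hp)
  rw [vsub_eq_sub] at h1
  have h2 : ‖v - p‖ ^ 2 = ‖v - u'‖ ^ 2 + ‖u' - p‖ ^ 2 := by
    rw [← sub_add_sub_cancel v u' p, norm_add_sq_real, h1]; ring
  have h3 : ‖v - p‖ ^ 2 = ‖u - p‖ ^ 2 - 2 * inner ℝ (u - v) (u - p) + ‖u - v‖ ^ 2 := by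
    have h4 : v - p = (u - p) - (u - v) := by abel
    rw [h4, norm_sub_sq_real, real_inner_comm]
  rw [inner_sub_right, hv.eq_coneProj hq, inner_sub_coneProj_self hs,
    inner_sub_coneProj_of_lorentzForm hs hpu, norm_sub_coneProj_sq hs] at h3
  rw [hv.eq_coneProj hq] at h2
  have h5 : p 0 * (spatialNorm u - u 0) ^ 2 / spatialNorm u =
    2 * (p 0 * (spatialNorm u - u 0) ^ 2 / (2 * spatialNorm u)) := by field_simp
  nlinarith [sq_nonneg ‖coneProj u - u'‖]

/-- Compactness of the unit sphere: positive definiteness on a subspace is coercivity. -/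
theorem exists_mul_norm_sq_le_lorentzForm (L : Submodule ℝ (EuclideanSpace ℝ (Fin (n + 1))))
    (hL : ∀ h ∈ L, h ≠ 0 → 0 < lorentzForm h h) :
    ∃ c : ℝ, 0 < c ∧ c ≤ 1 ∧ ∀ h ∈ L, c * ‖h‖ ^ 2 ≤ lorentzForm h h := by
  have hcont : Continuous fun h : EuclideanSpace ℝ (Fin (n + 1)) => lorentzForm h h := by
    unfold lorentzForm; fun_prop
  have hK : IsCompact (Metric.sphere (0 : EuclideanSpace ℝ (Fin (n + 1))) 1 ∩ L) :=
    (isCompact_sphere _ _).inter_right L.closed_of_finiteDimensional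
  have hpos : ∃ c : ℝ, 0 < c ∧
      ∀ h ∈ Metric.sphere (0 : EuclideanSpace ℝ (Fin (n + 1))) 1 ∩ L, c ≤ lorentzForm h h := by
    rcases (Metric.sphere (0 : EuclideanSpace ℝ (Fin (n + 1))) 1 ∩ L).eq_empty_or_nonempty
      with he | hne
    · exact ⟨1, one_pos, fun h hh => by simp [he] at hh⟩
    · obtain ⟨x, hx, hmin⟩ := hK.exists_isMinOn hne hcont.continuousOn
      refine ⟨_, hL x hx.2 ?_, fun h hh => hmin hh⟩
      rintro rfl
      simpa using hx.1
  obtain ⟨c, hc, hcs⟩ := hpos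
  refine ⟨min c 1, lt_min hc one_pos, min_le_right _ _, fun h hh => ?_⟩
  by_cases h0 : h = 0
  · simp [h0, lorentzForm]
  have hn : 0 < ‖h‖ := norm_pos_iff.2 h0
  have h1 := hcs (‖h‖⁻¹ • h) ⟨by simp [norm_smul, hn.ne'], L.smul_mem _ hh⟩
  have h2 := lorentzForm_self_add_smul (x := h) (y := 0) ‖h‖⁻¹ 0
  simp only [zero_smul, add_zero] at h2
  have h3 : lorentzForm (‖h‖⁻¹ • h) (‖h‖⁻¹ • h) = lorentzForm h h / ‖h‖ ^ 2 := by
    rw [h2]; field_simp; ring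
  rw [h3, le_div_iff₀ (by positivity)] at h1
  exact (mul_le_mul_of_nonneg_right (min_le_left _ _) (by positivity)).trans h1

theorem IsAlternatingProjSeq.mem {E : Type*} [PseudoMetricSpace E] {H K : Set E} {u : ℕ → E}
    (hu : IsAlternatingProjSeq H K u) : ∀ k, u k ∈ H
  | 0 => hu.1
  | k + 1 => (hu.2 k).choose_spec.2.1

theorem convergesLinearly_of_le {E : Type*} [NormedAddCommGroup E] {u : ℕ → E} {w : E} {r : ℝ}
    (h0 : 0 < r) (h1 : r < 1) (h : ∀ k, ‖u (k + 1) - w‖ ≤ r * ‖u k - w‖) :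
    ConvergesLinearly u w := by
  refine ⟨?_, r, h0, h1, h⟩
  have hb : ∀ k, ‖u k - w‖ ≤ r ^ k * ‖u 0 - w‖ := by
    intro k
    induction k with
    | zero => simp
    | succ k ih =>
      refine (h k).trans ?_
      rw [pow_succ', mul_assoc]
      exact mul_le_mul_of_nonneg_left ih h0.le
  refine tendsto_iff_norm_sub_tendsto_zero.2
    (squeeze_zero (fun k => norm_nonneg _) hb ?_)
  simpa using (tendsto_pow_atTop_nhds_zero_of_lt_one h0.le h1).mul_const ‖u 0 - w‖

/-! ### Intersection in the apex: linear rate -/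

theorem convergesLinearly_of_inter_eq_zero
    {u : ℕ → EuclideanSpace ℝ (Fin (n + 1))}
    (hu : IsAlternatingProjSeq (H : Set (EuclideanSpace ℝ (Fin (n + 1)))) (secondOrderCone n) u)
    (hHK : (H : Set (EuclideanSpace ℝ (Fin (n + 1)))) ∩ secondOrderCone n = {0}) :
    ConvergesLinearly u 0 := by
  have h0H : (0 : EuclideanSpace ℝ (Fin (n + 1))) ∈ H :=
    (hHK.ge (Set.mem_singleton _)).1
  have hdir : ∀ h, h ∈ H.direction ↔ h ∈ H := fun h => by
    rw [← AffineSubspace.vsub_right_mem_direction_iff_mem h0H h, vsub_eq_sub, sub_zero]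
  obtain ⟨c, hc, hc1, hcL⟩ := exists_mul_norm_sq_le_lorentzForm H.direction fun h hh hne => by
    by_contra hq
    rw [not_lt] at hq
    have key : ∀ g ∈ H.direction, lorentzForm g g ≤ 0 → 0 ≤ g 0 → g = 0 := fun g hg hgq hg0 =>
      hHK.le ⟨(hdir g).1 hg, mem_secondOrderCone_of_lorentzForm hg0 hgq⟩
    rcases le_total 0 (h 0) with hs | hs
    · exact hne (key h hh hq hs)
    · refine hne (neg_eq_zero.1 (key (-h) (H.direction.neg_mem hh) ?_ ?_))
      · rw [lorentzForm_self] at hq ⊢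
        simpa using hq
      · simpa using hs
  have hc2 : 0 < 1 - c ^ 2 / 8 := by nlinarith
  refine convergesLinearly_of_le (r := Real.sqrt (1 - c ^ 2 / 8)) (Real.sqrt_pos.2 hc2) ?_ ?_
  · rw [Real.sqrt_lt' one_pos]
    nlinarith [sq_pos_of_pos hc]
  intro k
  obtain ⟨v, hv, hv'⟩ := hu.2 k
  have hcu := hcL _ ((hdir _).2 (hu.mem k))
  have hq : 0 ≤ lorentzForm (u k) (u k) := le_trans (by positivity) hcu
  -- The iteration may reach `0`, where it stays.
  by_cases hs : spatialNorm (u k) = 0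
  · have hz := eq_zero_of_spatialNorm_eq_zero hq hs
    have h1 := hv.eq_coneProj hq
    rw [hz, coneProj_zero] at h1
    have h2 := hv'.2 0 h0H
    rw [h1, dist_self] at h2
    have h3 : u (k + 1) = 0 := (dist_le_zero.1 h2).symm
    rw [h3, hz]
    simp
  have h1 := norm_altProj_sub_sq_le hv hv' h0H hq hs (by simp [lorentzForm])
  simp only [sub_zero, PiLp.zero_apply, zero_mul, zero_div, add_zero] at h1 ⊢
  have hx := abs_le.1 (abs_le_spatialNorm hq)
  have hsn := spatialNorm_le_norm (u k)
  rw [lorentzForm_self_eq_mul] at hcu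
  have hn : 0 < ‖u k‖ :=
    lt_of_lt_of_le (lt_of_le_of_ne (spatialNorm_nonneg _) (Ne.symm hs)) hsn
  have h2 : c * ‖u k‖ / 2 ≤ spatialNorm (u k) - u k 0 := by
    have h3 : (spatialNorm (u k) - u k 0) * (spatialNorm (u k) + u k 0) ≤
      (spatialNorm (u k) - u k 0) * (2 * ‖u k‖) :=
      mul_le_mul_of_nonneg_left (by linarith) (by linarith)
    nlinarith
  have h4 : (c * ‖u k‖ / 2) ^ 2 ≤ (spatialNorm (u k) - u k 0) ^ 2 :=
    pow_le_pow_left₀ (by positivity) h2 2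
  refine le_of_sq_le_sq ?_ (by positivity)
  rw [mul_pow, Real.sq_sqrt hc2.le]
  linarith

/-! ### Intersection in one nonzero point -/

/-- With `y = ‖u k - p‖²` the gap `δ = ‖(u k)₁‖ - (u k)₀` is comparable to `y`, and one step lowers
`y` by an amount comparable to `δ²`. -/
theorem convergesThetaInvSqrt_of_inter_eq_singleton
    (hint : (H : Set (EuclideanSpace ℝ (Fin (n + 1)))) ∩ interior (secondOrderCone n) = ∅)
    {u : ℕ → EuclideanSpace ℝ (Fin (n + 1))}
    (hu : IsAlternatingProjSeq (H : Set (EuclideanSpace ℝ (Fin (n + 1)))) (secondOrderCone n) u)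
    (hu0 : u 0 ∉ secondOrderCone n) (hp : p ≠ 0)
    (hHK : (H : Set (EuclideanSpace ℝ (Fin (n + 1)))) ∩ secondOrderCone n = {p}) :
    ConvergesThetaInvSqrt u p := by
  obtain ⟨hpH, hpK⟩ := hHK.ge (Set.mem_singleton p)
  have hp0 := zero_lt_apply_zero_of_mem hpK hp
  have hpp : lorentzForm p p = 0 := by
    rw [lorentzForm_self_eq_mul, spatialNorm_eq_of_mem hint hpH hpK, sub_self, zero_mul]
  have hperp : ∀ h ∈ H.direction, lorentzForm p h = 0 := fun h hh =>
    lorentzForm_direction_eq_zero hint hpH hpK hp hh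
  obtain ⟨c, hc, -, hcL⟩ := exists_mul_norm_sq_le_lorentzForm H.direction fun h hh hne => by
    rw [lorentzForm_self_eq_norm_sq hp0.ne' hpp (hperp h hh)]
    refine pow_pos (norm_pos_iff.2 fun hz => ?_) 2
    -- A null direction is a multiple of `p`; then `2 p` is a second point of `H` in the cone.
    have hh' := sub_eq_zero.1 hz
    have ha : h 0 / p 0 ≠ 0 := fun ha => hne (by rw [hh', ha, zero_smul])
    have hpd : p ∈ H.direction := by
      have := H.direction.smul_mem (h 0 / p 0)⁻¹ hh
      rwa [hh', PiLp.smul_apply, smul_eq_mul, div_mul_cancel₀ _ hp0.ne', smul_smul,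
        inv_mul_cancel₀ ha, one_smul] at this
    have h2 : p + p ∈ H := AffineSubspace.vadd_mem_of_mem_direction hpd hpH
    have h3 : p + p ∈ secondOrderCone n := by
      apply mem_secondOrderCone_of_lorentzForm
      · simpa using hp0.le
      · have := lorentzForm_self_add_smul (x := p) (y := p) 1 1
        rw [hpp, one_smul] at this
        rw [this]
        simp
    have h4 : p + p = p := hHK.le ⟨h2, h3⟩
    exact hp (by simpa using h4)
  have hmem : ∀ k, u k - p ∈ H.direction := fun k =>
    AffineSubspace.vsub_mem_direction (hu.mem k) hpH
  have hpu : ∀ k, lorentzForm p (u k) = 0 := fun k => by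
    have h1 := hperp _ (hmem k)
    rw [lorentzForm, inner_sub_right, PiLp.sub_apply] at h1
    rw [lorentzForm] at hpp ⊢
    linarith
  have hqu : ∀ k, lorentzForm (u k) (u k) = lorentzForm (u k - p) (u k - p) := fun k => by
    have h1 := lorentzForm_self_add_smul (x := u k) (y := p) 1 (-1)
    rw [one_smul, neg_smul, one_smul, ← sub_eq_add_neg, hpp, lorentzForm_comm (y := p), hpu] at h1
    rw [h1]; ring
  have hcu : ∀ k, c * ‖u k - p‖ ^ 2 ≤ lorentzForm (u k) (u k) := fun k => by
    rw [hqu]; exact hcL _ (hmem k)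
  have hq : ∀ k, 0 ≤ lorentzForm (u k) (u k) := fun k => le_trans (by positivity) (hcu k)
  have hs : ∀ k, 0 < spatialNorm (u k) := fun k => by
    refine lt_of_le_of_ne (spatialNorm_nonneg _) fun hs => ?_
    have hz := eq_zero_of_spatialNorm_eq_zero (hq k) hs.symm
    have h1 : (0 : EuclideanSpace ℝ (Fin (n + 1))) ∈ ({p} : Set _) :=
      hHK.le ⟨hz ▸ hu.mem k, by simp [secondOrderCone]⟩
    exact hp h1.symm
  have hx : ∀ k, -spatialNorm (u k) ≤ u k 0 ∧ u k 0 ≤ spatialNorm (u k) := fun k =>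
    abs_le.1 (abs_le_spatialNorm (hq k))
  have hprod : ∀ k, lorentzForm (u k) (u k) = (spatialNorm (u k) - u k 0) *
    (spatialNorm (u k) + u k 0) := fun k => lorentzForm_self_eq_mul _
  have hup : ∀ k, ‖u (k + 1) - p‖ ^ 2 ≤ ‖u k - p‖ ^ 2 - ((spatialNorm (u k) - u k 0) ^ 2 / 2 +
      p 0 * (spatialNorm (u k) - u k 0) ^ 2 / spatialNorm (u k)) := fun k => by
    obtain ⟨v, hv, hv'⟩ := hu.2 k
    exact norm_altProj_sub_sq_le hv hv' hpH (hq k) (hs k).ne' (hpu k)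
  have hlow : ∀ k, inner ℝ (u (k + 1) - p) (u k - p) = ‖u k - p‖ ^ 2 -
      ((spatialNorm (u k) - u k 0) ^ 2 / 2 +
        p 0 * (spatialNorm (u k) - u k 0) ^ 2 / (2 * spatialNorm (u k))) := fun k => by
    obtain ⟨v, hv, hv'⟩ := hu.2 k
    exact inner_altProj_sub hv hv' (hu.mem k) hpH (hq k) (hs k).ne' (hpu k)
  have hterm : ∀ k, 0 ≤ p 0 * (spatialNorm (u k) - u k 0) ^ 2 / spatialNorm (u k) := fun k => by
    have := hs k
    positivity
  have hhalf : ∀ k, p 0 * (spatialNorm (u k) - u k 0) ^ 2 / (2 * spatialNorm (u k)) =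
      p 0 * (spatialNorm (u k) - u k 0) ^ 2 / spatialNorm (u k) / 2 := fun k => by
    have := (hs k).ne'
    field_simp
  -- The iteration never reaches `p`: `u (k + 1) = p` makes the two estimates contradict each other
  -- unless `δ = 0`, which gives `u k = p`.
  have hypos : ∀ k, 0 < ‖u k - p‖ ^ 2 := by
    intro k
    induction k with
    | zero =>
      refine pow_pos (norm_pos_iff.2 fun hz => hu0 ?_) 2
      rwa [sub_eq_zero.1 hz]
    | succ k ih =>
      refine pow_pos (norm_pos_iff.2 fun hz => ?_) 2
      have h1 := hup k
      have h2 := hlow k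
      rw [hz, norm_zero] at h1
      rw [hz, inner_zero_left, hhalf] at h2
      have h3 := hterm k
      have h4 : (spatialNorm (u k) - u k 0) ^ 2 / 2 = ‖u k - p‖ ^ 2 := by linarith
      have h5 : p 0 * (spatialNorm (u k) - u k 0) ^ 2 / spatialNorm (u k) = 0 := by linarith
      have h6 : 0 < (spatialNorm (u k) - u k 0) ^ 2 := by linarith
      have := hs k
      have : 0 < p 0 * (spatialNorm (u k) - u k 0) ^ 2 / spatialNorm (u k) := by positivity
      linarith
  have hmono : ∀ k, ‖u k - p‖ ≤ ‖u 0 - p‖ := by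
    intro k
    induction k with
    | zero => exact le_rfl
    | succ k ih =>
      refine le_trans ?_ ih
      refine le_of_sq_le_sq ?_ (norm_nonneg _)
      have := hup k
      nlinarith [hterm k, sq_nonneg (spatialNorm (u k) - u k 0)]
  -- A bound for `s + x₀`, so that `δ = lorentzForm / (s + x₀)` is at least `c y / M`.
  set M : ℝ := 2 * (‖u 0 - p‖ + ‖p‖) with hM
  have hM0 : 0 < M := by have := norm_pos_iff.2 hp; positivity
  have hsM : ∀ k, spatialNorm (u k) + u k 0 ≤ M := fun k => by
    have h1 := spatialNorm_le_norm (u k)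
    have h2 := (hx k).2
    have h3 : ‖u k‖ ≤ ‖u k - p‖ + ‖p‖ := by simpa using norm_add_le (u k - p) p
    linarith [hmono k]
  have hdec : ∀ k, ‖u (k + 1) - p‖ ^ 2 ≤
      ‖u k - p‖ ^ 2 - (c / M) ^ 2 / 2 * (‖u k - p‖ ^ 2) ^ 2 := fun k => by
    have h1 : c / M * ‖u k - p‖ ^ 2 ≤ spatialNorm (u k) - u k 0 := by
      rw [div_mul_eq_mul_div, div_le_iff₀ hM0]
      refine (hcu k).trans ?_
      rw [hprod]
      exact mul_le_mul_of_nonneg_left (hsM k) (by linarith [(hx k).2])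
    have h2 := pow_le_pow_left₀ (by positivity) h1 2
    have h3 := hup k
    have h4 := hterm k
    rw [mul_pow] at h2
    linarith
  have hlim : Tendsto (fun k => ‖u k - p‖ ^ 2) atTop (𝓝 0) :=
    tendsto_zero_of_quadratic_decrease (by positivity) hypos hdec
  -- The first bound keeps `(u k)₀ ≥ p₀ / 2`; the second makes `1 - (3 / 2) y / p₀²` nonnegative, so
  -- that the Cauchy–Schwarz inequality below may be squared.
  have hsmall : ∀ᶠ k in atTop, ‖u k - p‖ ^ 2 < min ((p 0 / 2) ^ 2) (p 0 ^ 2 / (3 / 2)) :=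
    hlim.eventually_lt_const (by positivity)
  have hge : ∀ᶠ k in atTop, ‖u k - p‖ ^ 2 - 3 / p 0 ^ 2 * (‖u k - p‖ ^ 2) ^ 2 ≤
      ‖u (k + 1) - p‖ ^ 2 := by
    filter_upwards [hsmall] with k hk
    obtain ⟨hk1, hk2⟩ := lt_min_iff.1 hk
    have hsk := hs k
    have h1 : p 0 / 2 ≤ u k 0 := by
      have h2 : ‖u k - p‖ < p 0 / 2 := lt_of_pow_lt_pow_left₀ 2 (by positivity) hk1
      have h3 : |(u k - p) 0| ≤ ‖u k - p‖ := by
        simpa using PiLp.norm_apply_le (u k - p) 0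
      have h4 := (abs_le.1 h3).1
      rw [PiLp.sub_apply] at h4
      linarith
    have h1' := (hx k).2
    set y := ‖u k - p‖ ^ 2 with hy
    set δ := spatialNorm (u k) - u k 0 with hδ
    have hδ0 : 0 ≤ δ := by linarith
    have hqy : lorentzForm (u k) (u k) ≤ y := by
      rw [hqu, lorentzForm_self]
      linarith [sq_nonneg ((u k - p) 0)]
    have h2 : δ * p 0 ≤ y := by
      refine le_trans ?_ hqy
      rw [hprod]
      exact mul_le_mul_of_nonneg_left (by linarith) hδ0
    have h3 : δ ^ 2 ≤ y ^ 2 / p 0 ^ 2 := by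
      rw [le_div_iff₀ (by positivity), ← mul_pow]
      exact pow_le_pow_left₀ (by positivity) h2 2
    have h4 : p 0 * δ ^ 2 / (2 * spatialNorm (u k)) ≤ δ ^ 2 := by
      rw [div_le_iff₀ (by positivity), mul_comm]
      exact mul_le_mul_of_nonneg_left (by linarith) (sq_nonneg _)
    have hy0 : 0 < y := hypos k
    have h5 : y * (1 - 3 / 2 * (y / p 0 ^ 2)) ≤ inner ℝ (u (k + 1) - p) (u k - p) := by
      rw [hlow]
      have : y * (1 - 3 / 2 * (y / p 0 ^ 2)) = y - 3 / 2 * (y ^ 2 / p 0 ^ 2) := by ring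
      rw [this]
      linarith
    have h6 := real_inner_mul_inner_self_le (u (k + 1) - p) (u k - p)
    rw [real_inner_self_eq_norm_sq, real_inner_self_eq_norm_sq, ← hy] at h6
    have h7 : 0 ≤ 1 - 3 / 2 * (y / p 0 ^ 2) := by
      rw [lt_div_iff₀ (by positivity)] at hk2
      have : y / p 0 ^ 2 ≤ 2 / 3 := by
        rw [div_le_iff₀ (by positivity)]; linarith
      linarith
    have h8 := mul_self_le_mul_self (mul_nonneg hy0.le h7) h5
    have h9 : y * (1 - 3 / 2 * (y / p 0 ^ 2)) ^ 2 ≤ ‖u (k + 1) - p‖ ^ 2 := by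
      refine le_of_mul_le_mul_right ?_ hy0
      refine le_trans (le_of_eq ?_) (h8.trans h6)
      ring
    refine le_trans ?_ h9
    have : y - 3 / p 0 ^ 2 * y ^ 2 = y * (1 - 2 * (3 / 2 * (y / p 0 ^ 2))) := by ring
    rw [this]
    exact mul_le_mul_of_nonneg_left (by nlinarith [sq_nonneg (3 / 2 * (y / p 0 ^ 2))]) hy0.le
  have hΘ := isTheta_sqrt_of_quadratic_decrease (by positivity) (by positivity) hypos hdec hge
  simp only [Real.sqrt_sq (norm_nonneg _)] at hΘ
  exact .of_isTheta hΘ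

end

/-! ### Intersection in a ray -/

section

variable {n : ℕ} {H : AffineSubspace ℝ (EuclideanSpace ℝ (Fin (n + 1)))}
  {u v u' d : EuclideanSpace ℝ (Fin (n + 1))}

/-- If `H` is a linear subspace containing the null vector `d` and Lorentz-orthogonal to it, then the
unit vector of the time axis projects onto `H` as `d / (2 d₀)`, so the step stays in the plane of `u`
and `d`. -/
theorem altProj_eq_of_mem_direction (hv : IsMetricProj (secondOrderCone n) u v)
    (hu' : IsMetricProj (H : Set (EuclideanSpace ℝ (Fin (n + 1)))) v u')
    (hu : u ∈ H) (hdir : ∀ h, h ∈ H.direction ↔ h ∈ H) (hd : d ∈ H) (hd0 : d 0 ≠ 0)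
    (hperp : ∀ h ∈ H.direction, lorentzForm d h = 0) (hq : 0 ≤ lorentzForm u u) :
    u' = ((1 + u 0 / spatialNorm u) / 2) • u +
      (lorentzForm u u / (4 * spatialNorm u * d 0)) • d := by
  set r := ((1 + u 0 / spatialNorm u) / 2) • u +
      (lorentzForm u u / (4 * spatialNorm u * d 0)) • d with hr
  have hrH : r ∈ H.direction := H.direction.add_mem (H.direction.smul_mem _ ((hdir _).2 hu))
    (H.direction.smul_mem _ ((hdir _).2 hd))
  have hg : u' - r ∈ H.direction := H.direction.sub_mem ((hdir _).2 hu'.1) hrH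
  have h1 := hu'.inner_sub_eq_zero hg
  have h2 : inner ℝ (v - r) (u' - r) = 0 := by
    have h3 := hperp _ hg
    rw [lorentzForm] at h3
    have h4 : v - r = (lorentzForm u u / (2 * spatialNorm u)) •
        (EuclideanSpace.single 0 1 - (1 / (2 * d 0)) • d) := by
      rw [hv.eq_coneProj hq, hr, coneProj, add_sub_add_left_eq_sub, smul_sub, smul_smul]
      congr 2
      field_simp
      ring
    rw [h4, real_inner_smul_left, inner_sub_left, inner_single_zero, real_inner_smul_left,
      sub_eq_zero.1 h3]
    field_simp
    ring
  have h5 : inner ℝ (u' - r) (u' - r) = 0 := by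
    have h6 : u' - r = (v - r) - (v - u') := by abel
    conv_lhs => rw [h6, inner_sub_left, ← h6, h1, h2]
    simp
  exact sub_eq_zero.1 (inner_self_eq_zero.1 h5)

theorem altProj_apply_zero {u : EuclideanSpace ℝ (Fin (n + 1))} (hd0 : d 0 ≠ 0)
    (hs : spatialNorm u ≠ 0)
    (h : u' = ((1 + u 0 / spatialNorm u) / 2) • u +
      (lorentzForm u u / (4 * spatialNorm u * d 0)) • d) :
    u' 0 = u 0 + (spatialNorm u - u 0) ^ 2 / (4 * spatialNorm u) := by
  rw [h, PiLp.add_apply, PiLp.smul_apply, PiLp.smul_apply, smul_eq_mul, smul_eq_mul,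
    lorentzForm_self_eq_mul]
  field_simp
  ring

theorem lorentzForm_altProj {u : EuclideanSpace ℝ (Fin (n + 1))}
    (hdd : lorentzForm d d = 0) (hdu : lorentzForm d u = 0)
    (h : u' = ((1 + u 0 / spatialNorm u) / 2) • u +
      (lorentzForm u u / (4 * spatialNorm u * d 0)) • d) :
    lorentzForm u' u' = ((1 + u 0 / spatialNorm u) / 2) ^ 2 * lorentzForm u u := by
  rw [h, lorentzForm_self_add_smul, hdd, lorentzForm_comm (x := u) (y := d), hdu]
  ring

/-- The iteration is a recurrence for the two numbers `x₀ = (u k)₀` and `z = lorentzForm (u k) (u k)`,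
where `√z` is the distance to the line through `d`. Here `x₀` increases to a positive limit `X`, `z`
decreases quadratically, and `X - x₀ = O(√z)`. -/
theorem eq_zero_or_convergesThetaInvSqrt_of_inter_eq_halfLine
    (hint : (H : Set (EuclideanSpace ℝ (Fin (n + 1)))) ∩ interior (secondOrderCone n) = ∅)
    {u : ℕ → EuclideanSpace ℝ (Fin (n + 1))}
    (hu : IsAlternatingProjSeq (H : Set (EuclideanSpace ℝ (Fin (n + 1)))) (secondOrderCone n) u)
    (hu0 : u 0 ∉ secondOrderCone n) (hd : d ≠ 0)
    (hHK : (H : Set (EuclideanSpace ℝ (Fin (n + 1)))) ∩ secondOrderCone n = halfLine d) :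
    u 1 = 0 ∨ ∃ w ∈ halfLine d, w ≠ 0 ∧ ConvergesThetaInvSqrt u w := by
  have h0H : (0 : EuclideanSpace ℝ (Fin (n + 1))) ∈ H := by
    have : (0 : EuclideanSpace ℝ (Fin (n + 1))) ∈ halfLine d := ⟨0, le_rfl, by simp⟩
    rw [← hHK] at this
    exact this.1
  obtain ⟨hdH, hdK⟩ : d ∈ (H : Set (EuclideanSpace ℝ (Fin (n + 1)))) ∩ secondOrderCone n := by
    rw [hHK]
    exact ⟨1, zero_le_one, by simp⟩
  have hd0 := zero_lt_apply_zero_of_mem hdK hd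
  have hdd : lorentzForm d d = 0 := by
    rw [lorentzForm_self_eq_mul, spatialNorm_eq_of_mem hint hdH hdK, sub_self, zero_mul]
  have hperp : ∀ h ∈ H.direction, lorentzForm d h = 0 := fun h hh =>
    lorentzForm_direction_eq_zero hint hdH hdK hd hh
  have hdir : ∀ h, h ∈ H.direction ↔ h ∈ H := fun h => by
    rw [← AffineSubspace.vsub_right_mem_direction_iff_mem h0H h, vsub_eq_sub, sub_zero]
  have hdu : ∀ k, lorentzForm d (u k) = 0 := fun k => hperp _ ((hdir _).2 (hu.mem k))
  have hq : ∀ k, 0 ≤ lorentzForm (u k) (u k) := fun k => by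
    rw [lorentzForm_self_eq_norm_sq hd0.ne' hdd (hdu k)]
    positivity
  have hstep : ∀ k, u (k + 1) = ((1 + u k 0 / spatialNorm (u k)) / 2) • u k +
      (lorentzForm (u k) (u k) / (4 * spatialNorm (u k) * d 0)) • d := fun k => by
    obtain ⟨v, hv, hv'⟩ := hu.2 k
    exact altProj_eq_of_mem_direction hv hv' (hu.mem k) hdir hdH hd0.ne' hperp (hq k)
  have hx : ∀ k, -spatialNorm (u k) ≤ u k 0 ∧ u k 0 ≤ spatialNorm (u k) := fun k =>
    abs_le.1 (abs_le_spatialNorm (hq k))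
  have hprod : ∀ k, lorentzForm (u k) (u k) = (spatialNorm (u k) - u k 0) *
    (spatialNorm (u k) + u k 0) := fun k => lorentzForm_self_eq_mul _
  rcases (hq 0).eq_or_lt with hz | hz
  -- A null `u 0` outside the cone lies on the opposite ray, which is mapped to `0`.
  · left
    have hlt : u 0 0 < spatialNorm (u 0) := not_le.1 hu0
    have h1 : spatialNorm (u 0) + u 0 0 = 0 := by
      rw [hprod] at hz
      exact (mul_eq_zero.1 hz.symm).resolve_left (by linarith)
    have h2 : spatialNorm (u 0) ≠ 0 := by intro h; linarith
    have h3 : 1 + u 0 0 / spatialNorm (u 0) = 0 := by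
      field_simp
      rw [h1, mul_zero]
    have h4 := hstep 0
    rw [← hz, h3] at h4
    simpa using h4
  right
  have hs_of : ∀ k, 0 < lorentzForm (u k) (u k) →
      0 < spatialNorm (u k) - u k 0 ∧ 0 < spatialNorm (u k) + u k 0 := fun k hk => by
    rw [hprod] at hk
    have h1 := hx k
    rcases pos_and_pos_or_neg_and_neg_of_mul_pos hk with h | h
    · exact h
    · linarith
  have hform : ∀ k, lorentzForm (u (k + 1)) (u (k + 1)) =
      ((1 + u k 0 / spatialNorm (u k)) / 2) ^ 2 * lorentzForm (u k) (u k) := fun k =>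
    lorentzForm_altProj hdd (hdu k) (hstep k)
  have hypos : ∀ k, 0 < lorentzForm (u k) (u k) := by
    intro k
    induction k with
    | zero => exact hz
    | succ k ih =>
      obtain ⟨h1, h2⟩ := hs_of k ih
      have hs : 0 < spatialNorm (u k) := by linarith
      have h3 : 0 < 1 + u k 0 / spatialNorm (u k) := by
        have : 1 + u k 0 / spatialNorm (u k) = (spatialNorm (u k) + u k 0) / spatialNorm (u k) := by
          field_simp
        rw [this]; positivity
      rw [hform]
      positivity
  have hδ : ∀ k, 0 < spatialNorm (u k) - u k 0 := fun k => (hs_of k (hypos k)).1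
  have hσ : ∀ k, 0 < spatialNorm (u k) + u k 0 := fun k => (hs_of k (hypos k)).2
  have hs : ∀ k, 0 < spatialNorm (u k) := fun k => by linarith [hδ k, hσ k]
  have hx0 : ∀ k, u (k + 1) 0 = u k 0 + (spatialNorm (u k) - u k 0) ^ 2 / (4 * spatialNorm (u k)) :=
    fun k => altProj_apply_zero hd0.ne' (hs k).ne' (hstep k)
  have hxmono : Monotone fun k => u k 0 := monotone_nat_of_le_succ fun k => by
    have := hs k
    rw [hx0]
    have : 0 ≤ (spatialNorm (u k) - u k 0) ^ 2 / (4 * spatialNorm (u k)) := by positivity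
    linarith
  set a := u 1 0 with ha
  have ha0 : 0 < a := by
    -- Even if `(u 0)₀` is negative, one step makes this coordinate positive.
    have h1 : u 1 0 = (spatialNorm (u 0) + u 0 0) ^ 2 / (4 * spatialNorm (u 0)) := by
      rw [hx0 0]
      have := (hs 0).ne'
      field_simp
      ring
    have := hs 0
    have := hσ 0
    rw [ha, h1]
    positivity
  have hxa : ∀ k, 1 ≤ k → a ≤ u k 0 := fun k hk => hxmono hk
  have hnorm : ∀ k, ‖u k‖ ≤ ‖u 0‖ := by
    intro k
    induction k with
    | zero => exact le_rfl
    | succ k ih =>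
      refine le_trans (le_of_sq_le_sq ?_ (norm_nonneg _)) ih
      obtain ⟨v, hv, hv'⟩ := hu.2 k
      have h1 := norm_altProj_sub_sq_le hv hv' h0H (hq k) (hs k).ne' (by simp [lorentzForm])
      simp only [sub_zero, PiLp.zero_apply, zero_mul, zero_div, add_zero] at h1
      linarith [sq_nonneg (spatialNorm (u k) - u k 0)]
  set M := ‖u 0‖ with hM
  have hsM : ∀ k, spatialNorm (u k) ≤ M := fun k => (spatialNorm_le_norm _).trans (hnorm k)
  have hM0 : 0 < M := (hs 0).trans_le (hsM 0)
  have hgap : ∀ k, u k 0 / spatialNorm (u k) = 1 - lorentzForm (u k) (u k) /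
      (spatialNorm (u k) * (spatialNorm (u k) + u k 0)) := fun k => by
    have h1 := (hs k).ne'
    have h2 := (hσ k).ne'
    rw [hprod]
    field_simp
    ring
  have hdec : ∀ k, lorentzForm (u (k + 1)) (u (k + 1)) ≤
      lorentzForm (u k) (u k) - 1 / (4 * M ^ 2) * lorentzForm (u k) (u k) ^ 2 := fun k => by
    have h1 := hs k
    have h2 := hσ k
    have hy := hypos k
    rw [hform, hgap]
    set y := lorentzForm (u k) (u k) with hyd
    set g := y / (spatialNorm (u k) * (spatialNorm (u k) + u k 0)) with hg
    have hg2 : g ≤ 2 := by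
      have h3 := hgap k
      have h4 : -1 ≤ u k 0 / spatialNorm (u k) := by
        rw [le_div_iff₀ h1]; linarith [(hx k).1]
      linarith
    have hgy : y / (2 * M ^ 2) ≤ g := by
      apply div_le_div_of_nonneg_left hy.le (by positivity)
      have h5 := hsM k
      have h6 : spatialNorm (u k) + u k 0 ≤ 2 * M := by linarith [hδ k]
      calc _ ≤ M * (2 * M) := mul_le_mul h5 h6 h2.le hM0.le
        _ = _ := by ring
    have hg0 : 0 ≤ g := by positivity
    have h7 : ((1 + (1 - g)) / 2) ^ 2 ≤ 1 - y / (4 * M ^ 2) := by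
      have h8 : y / (4 * M ^ 2) = y / (2 * M ^ 2) / 2 := by field_simp; ring
      rw [h8]
      nlinarith
    refine (mul_le_mul_of_nonneg_right h7 hy.le).trans (le_of_eq ?_)
    ring
  have hge : ∀ᶠ k in atTop, lorentzForm (u k) (u k) -
      1 / (2 * a ^ 2) * lorentzForm (u k) (u k) ^ 2 ≤ lorentzForm (u (k + 1)) (u (k + 1)) := by
    filter_upwards [eventually_ge_atTop 1] with k hk
    have h1 := hs k
    have h2 := hσ k
    have hy := hypos k
    have hka := hxa k hk
    rw [hform, hgap]
    set y := lorentzForm (u k) (u k) with hyd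
    set g := y / (spatialNorm (u k) * (spatialNorm (u k) + u k 0)) with hg
    have hgy : g ≤ y / (2 * a ^ 2) := by
      apply div_le_div_of_nonneg_left hy.le (by positivity)
      have h5 : a ≤ spatialNorm (u k) := hka.trans (hx k).2
      calc 2 * a ^ 2 = a * (2 * a) := by ring
        _ ≤ _ := mul_le_mul h5 (by linarith) (by positivity) h1.le
    have h7 : 1 - y / (2 * a ^ 2) ≤ ((1 + (1 - g)) / 2) ^ 2 := by
      nlinarith [sq_nonneg g]
    refine le_trans (le_of_eq ?_) (mul_le_mul_of_nonneg_right h7 hy.le)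
    ring
  have hΘ := isTheta_sqrt_of_quadratic_decrease (by positivity) (by positivity) hypos hdec hge
  have hylim := tendsto_zero_of_quadratic_decrease (by positivity) hypos hdec
  have hbdd : BddAbove (Set.range fun k => u k 0) := by
    refine ⟨M, ?_⟩
    rintro _ ⟨k, rfl⟩
    exact (hx k).2.trans (hsM k)
  set X := ⨆ k, u k 0 with hX
  have hXlim : Tendsto (fun k => u k 0) atTop (𝓝 X) := tendsto_atTop_ciSup hxmono hbdd
  have hxX : ∀ k, u k 0 ≤ X := fun k => le_ciSup hbdd k
  have hX0 : 0 < X := ha0.trans_le (hxX 1)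
  -- `K` is chosen so that each increment of `x₀` is at most `K` times the decrement of `√z`; hence
  -- `x₀ + K √z` decreases to `X`, and dominates it.
  set K := M / (4 * a) with hK
  have hanti : ∀ k, 1 ≤ k → u (k + 1) 0 + K * Real.sqrt (lorentzForm (u (k + 1)) (u (k + 1))) ≤
      u k 0 + K * Real.sqrt (lorentzForm (u k) (u k)) := fun k hk => by
    have h1 := hs k
    have h2 := hσ k
    have h3 := hδ k
    have hka := hxa k hk
    have h4 : 0 ≤ (1 + u k 0 / spatialNorm (u k)) / 2 := by
      have : 0 ≤ u k 0 / spatialNorm (u k) := div_nonneg (by linarith) h1.le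
      linarith
    rw [hform, Real.sqrt_mul (sq_nonneg _), Real.sqrt_sq h4, hx0]
    set z := Real.sqrt (lorentzForm (u k) (u k)) with hzd
    have hz0 : 0 ≤ z := Real.sqrt_nonneg _
    have hzz : z ^ 2 = (spatialNorm (u k) - u k 0) * (spatialNorm (u k) + u k 0) := by
      rw [hzd, Real.sq_sqrt (hq k), hprod]
    have hzM : z ≤ M := by
      refine (Real.sqrt_le_left (norm_nonneg _)).2 ?_
      rw [lorentzForm_self]
      have := pow_le_pow_left₀ (norm_nonneg _) (hnorm k) 2
      linarith [sq_nonneg (u k 0)]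
    have h5 : spatialNorm (u k) - u k 0 ≤ 2 * K * z := by
      have h6 : (spatialNorm (u k) - u k 0) * (2 * a) ≤ M * z := by
        calc _ ≤ z ^ 2 := by
              rw [hzz]
              exact mul_le_mul_of_nonneg_left (by linarith) h3.le
          _ ≤ M * z := by rw [sq]; exact mul_le_mul_of_nonneg_right hzM hz0
      have h7 : 2 * K * z = M * z / (2 * a) := by rw [hK]; field_simp; ring
      rw [h7, le_div_iff₀ (by positivity)]
      exact h6
    have h8 : (spatialNorm (u k) - u k 0) ^ 2 / (4 * spatialNorm (u k)) ≤
        K * z * ((spatialNorm (u k) - u k 0) / (2 * spatialNorm (u k))) := by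
      have h9 : (spatialNorm (u k) - u k 0) ^ 2 / (4 * spatialNorm (u k)) =
        (spatialNorm (u k) - u k 0) / 2 *
          ((spatialNorm (u k) - u k 0) / (2 * spatialNorm (u k))) := by
        field_simp
        ring
      rw [h9]
      exact mul_le_mul_of_nonneg_right (by linarith) (by positivity)
    have h10 : K * ((1 + u k 0 / spatialNorm (u k)) / 2 * z) = K * z -
        K * z * ((spatialNorm (u k) - u k 0) / (2 * spatialNorm (u k))) := by
      field_simp
      ring
    rw [h10]
    linarith
  have hXle : ∀ k, 1 ≤ k → X - u k 0 ≤ K * Real.sqrt (lorentzForm (u k) (u k)) := fun k hk => by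
    have h1 : ∀ j, u (k + j) 0 + K * Real.sqrt (lorentzForm (u (k + j)) (u (k + j))) ≤
        u k 0 + K * Real.sqrt (lorentzForm (u k) (u k)) := by
      intro j
      induction j with
      | zero => exact le_rfl
      | succ j ih => exact (hanti (k + j) (by omega)).trans ih
    have h2 : X ≤ u k 0 + K * Real.sqrt (lorentzForm (u k) (u k)) := by
      refine le_of_tendsto hXlim (eventually_atTop.2 ⟨k, fun m hm => ?_⟩)
      obtain ⟨j, rfl⟩ := Nat.exists_eq_add_of_le hm
      refine le_trans ?_ (h1 j)
      have : 0 ≤ K * Real.sqrt (lorentzForm (u (k + j)) (u (k + j))) := by positivity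
      linarith
    linarith
  refine ⟨(X / d 0) • d, ⟨X / d 0, by positivity, rfl⟩, smul_ne_zero (by positivity) hd,
    .of_isTheta (IsTheta.trans ?_ hΘ)⟩
  have hdist : ∀ k, ‖u k - (X / d 0) • d‖ ^ 2 = lorentzForm (u k) (u k) + 2 * (X - u k 0) ^ 2 :=
    fun k => by
    have h1 := lorentzForm_self_add_smul (x := u k) (y := d) 1 (-(X / d 0))
    rw [one_smul, neg_smul, ← sub_eq_add_neg, hdd, lorentzForm_comm (x := u k) (y := d), hdu,
      lorentzForm_self] at h1
    have h2 : (u k - (X / d 0) • d) 0 = u k 0 - X := by simp [hd0.ne']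
    rw [h2] at h1
    linarith
  constructor
  · refine IsBigO.of_bound (Real.sqrt (1 + 2 * K ^ 2)) ?_
    filter_upwards [eventually_ge_atTop 1] with k hk
    rw [norm_norm, Real.norm_of_nonneg (Real.sqrt_nonneg _), ← Real.sqrt_mul (by positivity)]
    refine Real.le_sqrt_of_sq_le ?_
    rw [hdist]
    have h1 := pow_le_pow_left₀ (by linarith [hxX k]) (hXle k hk) 2
    rw [mul_pow, Real.sq_sqrt (hq k)] at h1
    linarith
  · refine IsBigO.of_bound 1 (Eventually.of_forall fun k => ?_)
    rw [norm_norm, Real.norm_of_nonneg (Real.sqrt_nonneg _), one_mul]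
    refine (Real.sqrt_le_left (norm_nonneg _)).2 ?_
    rw [hdist]
    linarith [sq_nonneg (X - u k 0)]

end

/-! ### The trichotomy -/

theorem theorem1 (n : ℕ) (hn : 2 < n + 1)
    (H : AffineSubspace ℝ (EuclideanSpace ℝ (Fin (n + 1))))
    (hne : ((H : Set (EuclideanSpace ℝ (Fin (n + 1)))) ∩ secondOrderCone n).Nonempty)
    (hint : (H : Set (EuclideanSpace ℝ (Fin (n + 1)))) ∩ interior (secondOrderCone n) = ∅)
    (u : ℕ → EuclideanSpace ℝ (Fin (n + 1)))
    (hu : IsAlternatingProjSeq (H : Set (EuclideanSpace ℝ (Fin (n + 1)))) (secondOrderCone n) u)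
    (hu0 : u 0 ∉ secondOrderCone n) :
    ((H : Set (EuclideanSpace ℝ (Fin (n + 1)))) ∩ frontier (secondOrderCone n) = {0} →
      ConvergesLinearly u 0) ∧
    (∀ uStar : EuclideanSpace ℝ (Fin (n + 1)), uStar ≠ 0 →
      (H : Set (EuclideanSpace ℝ (Fin (n + 1)))) ∩ frontier (secondOrderCone n) = {uStar} →
      ConvergesThetaInvSqrt u uStar) ∧
    (∀ d ∈ frontier (secondOrderCone n), d ≠ 0 →
      (H : Set (EuclideanSpace ℝ (Fin (n + 1)))) ∩ frontier (secondOrderCone n) = halfLine d →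
      u 1 = 0 ∨ ∃ w ∈ halfLine d, w ≠ 0 ∧ ConvergesThetaInvSqrt u w) := by
  rw [inter_frontier_secondOrderCone hint]
  exact ⟨convergesLinearly_of_inter_eq_zero hu,
    fun _ hp => convergesThetaInvSqrt_of_inter_eq_singleton hint hu hu0 hp,
    fun _ _ hd => eq_zero_or_convergesThetaInvSqrt_of_inter_eq_halfLine hint hu hu0 hd⟩
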